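/- Let $q$ be a complex number with $|q|<1$. For $x\in\mathbb{C}$, a complex number $p$ with $|p|<1$ and an integer $n\ge 0$ write $$(x;p)_n=\prod_{j=0}^{n-1}(1-xp^j),\qquad (x;p)_\infty=\prod_{j=0}^{\infty}(1-xp^j),\qquad (x_1,x_2,x_3;p)_\infty=(x_1;p)_\infty(x_2;p)_\infty(x_3;p)_\infty ,$$ $(q)_n=(q;q)_n$, $(q)_\infty=(q;q)_\infty$, and $$\begin{bmatrix} n\\ k\end{bmatrix}=\frac{(q)_n}{(q)_{n-k}(q)_k}\ \text{ if } 0\le k\le n,\qquad \begin{bmatrix} n\\ k\end{bmatrix}=0\ \text{ otherwise}.$$ Let $\delta_{a,i}=1$ if $a=i$ and $\delta_{a,i}=0$ otherwise. Theorem. Let $m\ge 1$ and $0\le a\le m-1$ be integers. Then the following multiple series converges absolutely, and $$\sum_{n_m,\dots,n_1\ge 0}\frac{q^{\binom{n_m+1}{2}+\cdots+\binom{n_1+1}{2}}}{(q)_{n_m}}\prod_{i=1}^{m-1}\begin{bmatrix} n_{i+1}+\delta_{a,i}\\ n_i\end{bmatrix}=\frac{\bigl(q^{a+1},q^{m+1-a},q^{m+2};q^{m+2}\bigr)_\infty}{(q)_\infty\,(q;q^2)_\infty}.$$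 -/

import Mathlib

/-- The finite `q`-shifted factorial `(a; q)_n = ∏_{j=0}^{n-1} (1 - a q^j)`. -/
noncomputable def qPoch (a q : ℂ) (n : ℕ) : ℂ :=
  ∏ j ∈ Finset.range n, (1 - a * q ^ j)

/-- The infinite `q`-shifted factorial `(a; q)_∞ = ∏_{j=0}^∞ (1 - a q^j)`. The product converges
whenever `|q| < 1`, see `multipliable_qPochInf`. -/
noncomputable def qPochInf (a q : ℂ) : ℂ :=
  ∏' j : ℕ, (1 - a * q ^ j)

theorem multipliable_qPochInf (a q : ℂ) (hq : ‖q‖ < 1) :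
    Multipliable (fun j : ℕ => 1 - a * q ^ j) := by
  have h : Summable (fun j : ℕ => ‖-(a * q ^ j)‖) := by
    simp only [norm_neg, norm_mul, norm_pow]
    exact (summable_geometric_of_lt_one (norm_nonneg q) hq).mul_left _
  simpa [sub_eq_add_neg] using multipliable_one_add_of_summable h

/-- The `q`-binomial coefficient `[n; k]_q = (q)_n / ((q)_{n-k} (q)_k)` for `0 ≤ k ≤ n`,
and `0` otherwise, where `(q)_n = (q; q)_n`. For `|q| < 1` the denominator is non-zero. -/
noncomputable def qBinom (q : ℂ) (n k : ℕ) : ℂ :=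
  if k ≤ n then qPoch q q n / (qPoch q q (n - k) * qPoch q q k) else 0

open Filter Topology Finset

/-! The inner sums are iterates of one Bailey lemma relative to `q` (`sum_qBinom_mul_baileySum`). If
(α, β) is a Bailey pair, summing (q)_n (-q)_n β_n against q^{C(n+1,2)} [L; n] gives (q)_L (-q)_L
β'_L, where α'_r = α_r q^{C(r+1,2)}. On α = `thetaTerm z w` a step sends w to wq.

The chain starts at the unit pair z = q, w = 1, whose first step gives the constant 1
(`baileySum_thetaTerm_self`). At level a the δ evaluates the sum at N + 1;
`baileySum_thetaTerm_shift` brings it back to N by exchanging (q, q^{a+1}) for (q^{a+1}, q). The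
remaining steps raise w only.

The sum over n_m is a last step with L → ∞. It leaves a theta series with z = q^{a+1}, w =
q^{m+1-a}, which the Jacobi triple product evaluates; Euler's identity turns (-q)_∞ into 1/(q;
q²)_∞. -/

/-! ### Shifted factorials and Euler's identity. -/

theorem qPoch_succ (a q : ℂ) (n : ℕ) : qPoch a q (n + 1) = qPoch a q n * (1 - a * q ^ n) :=
  prod_range_succ _ _

theorem qPoch_zero (a q : ℂ) : qPoch a q 0 = 1 := prod_range_zero _

theorem qPoch_succ' (a q : ℂ) (n : ℕ) : qPoch a q (n + 1) = (1 - a) * qPoch (a * q) q n := by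
  unfold qPoch
  rw [prod_range_succ', mul_comm]
  congr 1
  · simp
  · exact prod_congr rfl fun j _ => by ring

theorem qPoch_add (a q : ℂ) (m n : ℕ) :
    qPoch a q (m + n) = qPoch a q m * qPoch (a * q ^ m) q n := by
  unfold qPoch
  rw [prod_range_add]
  congr 1
  exact prod_congr rfl fun j _ => by ring

theorem one_sub_pow_ne_zero {q : ℂ} (hq : ‖q‖ < 1) (n : ℕ) : 1 - q ^ (n + 1) ≠ 0 := by
  intro h
  have h1 : ‖q ^ (n + 1)‖ = 1 := by rw [← sub_eq_zero.mp h, norm_one]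
  rw [norm_pow] at h1
  exact (pow_lt_one₀ (norm_nonneg q) hq n.succ_ne_zero).ne h1

theorem qPoch_self_ne_zero {q : ℂ} (hq : ‖q‖ < 1) (n : ℕ) : qPoch q q n ≠ 0 :=
  prod_ne_zero_iff.mpr fun j _ => by
    rw [← pow_succ']
    exact one_sub_pow_ne_zero hq j

theorem qPoch_self_succ (q : ℂ) (n : ℕ) :
    qPoch q q (n + 1) = qPoch q q n * (1 - q ^ (n + 1)) := by
  rw [qPoch_succ, pow_succ']

theorem tendsto_qPoch (a : ℂ) {q : ℂ} (hq : ‖q‖ < 1) :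
    Tendsto (qPoch a q) atTop (𝓝 (qPochInf a q)) :=
  (multipliable_qPochInf a q hq).hasProd.tendsto_prod_nat

theorem qPochInf_self_ne_zero {q : ℂ} (hq : ‖q‖ < 1) : qPochInf q q ≠ 0 := by
  have h := tprod_one_add_ne_zero_of_summable (f := fun j : ℕ => -(q * q ^ j)) (fun j => by
      rw [← pow_succ', ← sub_eq_add_neg]
      exact one_sub_pow_ne_zero hq j) (by
      simp only [norm_neg, norm_mul, norm_pow]
      exact (summable_geometric_of_lt_one (norm_nonneg q) hq).mul_left _)
  simpa [qPochInf, sub_eq_add_neg] using h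

/-- The odd powers of q give (q; q²)_n; the even ones split as 1 - q^{2j} = (1 - q^j)(1 + q^j). -/
theorem qPoch_self_two_mul (q : ℂ) (n : ℕ) :
    qPoch q q (2 * n) = qPoch q (q ^ 2) n * (qPoch q q n * qPoch (-q) q n) := by
  induction n with
  | zero => simp [qPoch_zero]
  | succ n ih =>
    rw [show 2 * (n + 1) = 2 * n + 1 + 1 by ring, qPoch_succ, qPoch_succ, ih, qPoch_succ, qPoch_succ,
      qPoch_succ]
    ring

/-- Euler's identity `(q; q²)_∞ (-q; q)_∞ = 1`. -/
theorem qPochInf_sq_mul_qPochInf_neg {q : ℂ} (hq : ‖q‖ < 1) :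
    qPochInf q (q ^ 2) * qPochInf (-q) q = 1 := by
  have hq2 : ‖q ^ 2‖ < 1 := by
    rw [norm_pow]; exact pow_lt_one₀ (norm_nonneg q) hq two_ne_zero
  have h1 : Tendsto (fun n => qPoch q q (2 * n)) atTop (𝓝 (qPochInf q q)) :=
    (tendsto_qPoch q hq).comp (tendsto_id.const_mul_atTop' two_pos)
  have h2 := (tendsto_qPoch q hq2).mul ((tendsto_qPoch q hq).mul (tendsto_qPoch (-q) hq))
  simp only [← qPoch_self_two_mul] at h2
  have h3 := tendsto_nhds_unique h1 h2
  apply mul_left_cancel₀ (qPochInf_self_ne_zero hq)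
  linear_combination -h3

/-! ### Reciprocal factorials and `q`-binomials. -/

/-- The reciprocal `1 / (q; q)_n`, extended by `0` to negative `n`. -/
noncomputable def qInv (q : ℂ) (n : ℤ) : ℂ :=
  if 0 ≤ n then (qPoch q q n.toNat)⁻¹ else 0

theorem qInv_natCast (q : ℂ) (n : ℕ) : qInv q n = (qPoch q q n)⁻¹ := by simp [qInv]

theorem qInv_of_neg (q : ℂ) {n : ℤ} (hn : n < 0) : qInv q n = 0 := if_neg (not_le.mpr hn)

theorem qInv_sub_one {q : ℂ} (hq : ‖q‖ < 1) (n : ℕ) :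
    qInv q ((n : ℤ) - 1) = (1 - q ^ n) * qInv q n := by
  cases n with
  | zero => simp [qInv_of_neg]
  | succ n =>
    rw [show ((n + 1 : ℕ) : ℤ) - 1 = (n : ℕ) by push_cast; ring, qInv_natCast, qInv_natCast,
      qPoch_self_succ, mul_inv]
    field_simp [one_sub_pow_ne_zero hq n]

theorem qInv_natCast_eq {q : ℂ} (hq : ‖q‖ < 1) (n : ℕ) :
    qInv q n = (1 - q ^ (n + 1)) * qInv q ((n + 1 : ℕ) : ℤ) := by
  rw [← qInv_sub_one hq]
  congr 1
  push_cast
  ring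

theorem exists_norm_qInv_le {q : ℂ} (hq : ‖q‖ < 1) : ∃ K, 0 ≤ K ∧ ∀ n, ‖qInv q n‖ ≤ K := by
  have h : Tendsto (fun n => ‖(qPoch q q n)⁻¹‖) atTop (𝓝 ‖(qPochInf q q)⁻¹‖) :=
    ((tendsto_qPoch q hq).inv₀ (qPochInf_self_ne_zero hq)).norm
  obtain ⟨K, hK⟩ := h.bddAbove_range
  have hK' : ∀ n, ‖(qPoch q q n)⁻¹‖ ≤ K := fun n => hK ⟨n, rfl⟩
  have hK0 : 0 ≤ K := (norm_nonneg _).trans (hK' 0)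
  refine ⟨K, hK0, fun n => ?_⟩
  unfold qInv
  split_ifs
  · exact hK' _
  · simpa using hK0

theorem exists_norm_qPoch_le (a : ℂ) {q : ℂ} (hq : ‖q‖ < 1) :
    ∃ K, 0 ≤ K ∧ ∀ n, ‖qPoch a q n‖ ≤ K := by
  obtain ⟨K, hK⟩ := (tendsto_qPoch a hq).norm.bddAbove_range
  have hK' : ∀ n, ‖qPoch a q n‖ ≤ K := fun n => hK ⟨n, rfl⟩
  exact ⟨K, (norm_nonneg _).trans (hK' 0), hK'⟩

theorem tendsto_qInv {q : ℂ} (hq : ‖q‖ < 1) : Tendsto (qInv q) atTop (𝓝 (qPochInf q q)⁻¹) := by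
  have h : Tendsto (fun n : ℕ => qInv q n) atTop (𝓝 (qPochInf q q)⁻¹) := by
    simp only [qInv_natCast]
    exact (tendsto_qPoch q hq).inv₀ (qPochInf_self_ne_zero hq)
  have h2 : Tendsto Int.toNat atTop atTop :=
    tendsto_atTop.2 fun b => (eventually_ge_atTop (b : ℤ)).mono fun x hx => by omega
  refine (h.comp h2).congr' ((eventually_ge_atTop 0).mono fun x hx => ?_)
  simp [Int.toNat_of_nonneg hx]

theorem qBinom_eq (q : ℂ) (n k : ℕ) :
    qBinom q n k = qPoch q q n * (qInv q k * qInv q ((n : ℤ) - k)) := by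
  unfold qBinom
  split_ifs with h
  · rw [← Nat.cast_sub h, qInv_natCast, qInv_natCast, div_eq_mul_inv, mul_inv]
    ring
  · rw [qInv_of_neg q (n := (n : ℤ) - k) (by omega)]
    ring

theorem qBinom_zero_right {q : ℂ} (hq : ‖q‖ < 1) (n : ℕ) : qBinom q n 0 = 1 := by
  simp [qBinom, qPoch_zero, qPoch_self_ne_zero hq]

theorem qBinom_of_lt (q : ℂ) {n k : ℕ} (h : n < k) : qBinom q n k = 0 := if_neg (by omega)

/-- The `q`-Pascal rule. -/
theorem qBinom_succ_succ {q : ℂ} (hq : ‖q‖ < 1) (k s : ℕ) :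
    qBinom q (k + s + 1) (s + 1) =
      qBinom q (k + s) (s + 1) + q ^ k * qBinom q (k + s) s := by
  have h1 : ((k + s + 1 : ℕ) : ℤ) - (s + 1 : ℕ) = (k : ℕ) := by push_cast; ring
  have h2 : ((k + s : ℕ) : ℤ) - (s + 1 : ℕ) = (k : ℕ) - 1 := by push_cast; ring
  have h3 : ((k + s : ℕ) : ℤ) - (s : ℕ) = (k : ℕ) := by push_cast; ring
  rw [qBinom_eq, qBinom_eq, qBinom_eq, h1, h2, h3, qInv_sub_one hq, qPoch_self_succ,
    qInv_natCast_eq hq s]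
  ring

/-! ### `q`-Chu–Vandermonde and the Bailey lemma. -/

/-- A polynomial form of the `q`-Chu–Vandermonde sum. -/
theorem sum_qBinom_mul_qPoch_mul_qPoch {q : ℂ} (hq : ‖q‖ < 1) (d : ℂ) (n : ℕ) (b : ℂ) :
    ∑ s ∈ range (n + 1), qBinom q n s * ((-d) ^ s * q ^ s.choose 2 * qPoch b q s *
      qPoch (b * d * q ^ s) q (n - s)) = qPoch d q n := by
  induction n generalizing b with
  | zero => simp [qPoch_zero, qBinom_zero_right hq]
  | succ n ih =>
    have pascal : ∀ s ∈ range (n + 1), qBinom q (n + 1) (s + 1) =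
        qBinom q n (s + 1) + q ^ (n - s) * qBinom q n s := fun s hs => by
      obtain ⟨k, rfl⟩ := Nat.exists_eq_add_of_le' (Nat.lt_succ_iff.mp (mem_range.mp hs))
      rw [qBinom_succ_succ hq, Nat.add_sub_cancel]
    -- Pascal gives one sum with the same b and one that, since (b)_{s+1} = (1 - b)(bq)_s, is the
    -- case bq. They recombine because (1 - bdq^n) - dq^n(1 - b) = 1 - dq^n.
    rw [sum_range_succ', sum_congr rfl fun s hs => by rw [pascal s hs, add_mul],
      sum_add_distrib, qBinom_zero_right hq, ← qBinom_zero_right hq n, add_right_comm,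
      ← sum_range_succ' (fun s => qBinom q n s * ((-d) ^ s * q ^ s.choose 2 * qPoch b q s *
      qPoch (b * d * q ^ s) q (n + 1 - s))), sum_range_succ, qBinom_of_lt q n.lt_succ_self,
      zero_mul, add_zero]
    have h1 : ∑ s ∈ range (n + 1), qBinom q n s * ((-d) ^ s * q ^ s.choose 2 * qPoch b q s *
        qPoch (b * d * q ^ s) q (n + 1 - s)) = (1 - b * d * q ^ n) * qPoch d q n := by
      rw [← ih b, mul_sum]
      refine sum_congr rfl fun s hs => ?_
      obtain ⟨k, rfl⟩ := Nat.exists_eq_add_of_le (Nat.lt_succ_iff.mp (mem_range.mp hs))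
      rw [show s + k + 1 - s = k + 1 by omega, Nat.add_sub_cancel_left, qPoch_succ]
      ring
    have h2 : ∑ s ∈ range (n + 1), q ^ (n - s) * qBinom q n s * ((-d) ^ (s + 1) *
        q ^ (s + 1).choose 2 * qPoch b q (s + 1) *
        qPoch (b * d * q ^ (s + 1)) q (n + 1 - (s + 1))) =
        -(d * q ^ n * (1 - b)) * qPoch d q n := by
      rw [← ih (b * q), mul_sum]
      refine sum_congr rfl fun s hs => ?_
      obtain ⟨k, rfl⟩ := Nat.exists_eq_add_of_le (Nat.lt_succ_iff.mp (mem_range.mp hs))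
      rw [Nat.add_sub_add_right, Nat.add_sub_cancel_left, qPoch_succ', Nat.choose_succ_succ' s 1,
        Nat.choose_one_right]
      ring_nf
    rw [h1, h2, qPoch_succ]
    ring

/-- The kernel `1 / ((q)_{L-r} (q)_{L+r+1})` of Bailey pairs relative to `q`. -/
noncomputable def baileyKernel (q : ℂ) (L r : ℕ) : ℂ :=
  qInv q ((L : ℤ) - r) * qInv q ((L : ℤ) + r + 1)

theorem baileyKernel_of_lt (q : ℂ) {L r : ℕ} (h : L < r) : baileyKernel q L r = 0 := by
  rw [baileyKernel, qInv_of_neg q (by omega), zero_mul]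

theorem baileyKernel_add (q : ℂ) (r k : ℕ) :
    baileyKernel q (r + k) r = (qPoch q q k)⁻¹ * (qPoch q q (2 * r + k + 1))⁻¹ := by
  rw [baileyKernel, ← qInv_natCast, ← qInv_natCast]
  congr 2
  · push_cast; ring
  · push_cast; ring

/-- The transform `α ↦ β`, where `(α, β)` is a Bailey pair relative to `q`. -/
noncomputable def baileySum (q : ℂ) (α : ℕ → ℂ) (L : ℕ) : ℂ :=
  ∑ r ∈ range (L + 1), α r * baileyKernel q L r

theorem baileySum_eq_sum_range (q : ℂ) (α : ℕ → ℂ) {L R : ℕ} (h : L + 1 ≤ R) :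
    baileySum q α L = ∑ r ∈ range R, α r * baileyKernel q L r := by
  refine sum_subset (range_subset_range.2 h) fun r _ hr => ?_
  rw [baileyKernel_of_lt q (by simpa using hr), mul_zero]

theorem baileyKernel_sum_add {q : ℂ} (hq : ‖q‖ < 1) (r k : ℕ) :
    ∑ s ∈ range (k + 1), q ^ (r + s + 1).choose 2 * qPoch (-q) q (r + s) *
      baileyKernel q (r + s) r * qInv q ((k : ℤ) - s) =
    qPoch (-q) q (r + k) * q ^ (r + 1).choose 2 * baileyKernel q (r + k) r := by
  -- With b = d = -q^{r+1}, (b)_s is the tail of (-q)_{r+s}, and bd = q^{2r+2} supplies the quotient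
  -- (q)_{2r+k+1} / (q)_{2r+s+1}.
  have key := sum_qBinom_mul_qPoch_mul_qPoch hq (-q ^ (r + 1)) k (-q ^ (r + 1))
  have e : ∀ n, qPoch (-q) q (r + n) = qPoch (-q) q r * qPoch (-q ^ (r + 1)) q n := fun n => by
    rw [qPoch_add, pow_succ', neg_mul]
  have h0 := qPoch_self_ne_zero hq
  rw [baileyKernel_add, e, ← key, mul_sum, sum_mul, sum_mul]
  refine sum_congr rfl fun s hs => ?_
  obtain ⟨t, rfl⟩ := Nat.exists_eq_add_of_le (Nat.lt_succ_iff.mp (mem_range.mp hs))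
  have e2 : qPoch q q (2 * r + (s + t) + 1) = qPoch q q (2 * r + s + 1) *
      qPoch (-q ^ (r + 1) * -q ^ (r + 1) * q ^ s) q t := by
    rw [show 2 * r + (s + t) + 1 = 2 * r + s + 1 + t by ring, qPoch_add]
    congr 2
    ring
  have e3 : (r + s + 1).choose 2 = (r + 1).choose 2 + s.choose 2 + (r + 1) * s := by
    clear hs e2 key
    induction s with
    | zero => simp
    | succ s ih =>
      rw [show r + (s + 1) + 1 = r + s + 1 + 1 by ring, Nat.choose_succ_succ' (r + s + 1) 1, ih,
        Nat.choose_succ_succ' s 1, Nat.choose_one_right, Nat.choose_one_right]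
      ring
  have e4 : qPoch (-q ^ (r + 1) * -q ^ (r + 1) * q ^ s) q t ≠ 0 :=
    right_ne_zero_of_mul (e2 ▸ h0 (2 * r + (s + t) + 1))
  rw [baileyKernel_add, e, qBinom_eq, e2, show ((s + t : ℕ) : ℤ) - s = t by push_cast; ring,
    qInv_natCast, qInv_natCast, Nat.add_sub_cancel_left, e3, neg_neg, ← pow_mul, pow_add, pow_add,
    mul_inv]
  generalize qPoch (-q ^ (r + 1) * -q ^ (r + 1) * q ^ s) q t = Z at *
  have := h0 (s + t)
  field_simp

theorem baileyKernel_sum {q : ℂ} (hq : ‖q‖ < 1) (L r : ℕ) :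
    ∑ n ∈ range (L + 1), q ^ (n + 1).choose 2 * qPoch (-q) q n * baileyKernel q n r *
      qInv q ((L : ℤ) - n) = qPoch (-q) q L * q ^ (r + 1).choose 2 * baileyKernel q L r := by
  rcases lt_or_ge L r with h | h
  · rw [baileyKernel_of_lt q h, mul_zero]
    refine sum_eq_zero fun n hn => ?_
    rw [baileyKernel_of_lt q (by have := mem_range.1 hn; omega), mul_zero, zero_mul]
  · obtain ⟨k, rfl⟩ := Nat.exists_eq_add_of_le h
    rw [← baileyKernel_sum_add hq, add_assoc, sum_range_add, sum_eq_zero, zero_add]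
    · refine sum_congr rfl fun s _ => ?_
      congr 2
      push_cast
      ring
    · intro n hn
      rw [baileyKernel_of_lt q (mem_range.1 hn), mul_zero, zero_mul]

/-- A Bailey lemma relative to `q`, with parameters `ρ₁ → ∞` and `ρ₂ = -q`. -/
theorem sum_baileySum_mul_qInv {q : ℂ} (hq : ‖q‖ < 1) (α : ℕ → ℂ) (L : ℕ) :
    ∑ n ∈ range (L + 1), q ^ (n + 1).choose 2 * (qPoch (-q) q n * baileySum q α n) *
      qInv q ((L : ℤ) - n) =
    qPoch (-q) q L * baileySum q (fun r => α r * q ^ (r + 1).choose 2) L := by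
  have h : ∀ n ∈ range (L + 1), q ^ (n + 1).choose 2 * (qPoch (-q) q n * baileySum q α n) *
      qInv q ((L : ℤ) - n) = ∑ r ∈ range (L + 1), α r * (q ^ (n + 1).choose 2 *
        qPoch (-q) q n * baileyKernel q n r * qInv q ((L : ℤ) - n)) := fun n hn => by
    rw [baileySum_eq_sum_range q α (Nat.succ_le_of_lt (mem_range.1 hn)), mul_sum, mul_sum, sum_mul]
    exact sum_congr rfl fun r _ => by ring
  rw [sum_congr rfl h, sum_comm, baileySum, mul_sum]
  refine sum_congr rfl fun r _ => ?_
  rw [← mul_sum, baileyKernel_sum hq]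
  ring

/-- The Bailey lemma for the sequence `γ` with `γ n / (q)_n = (-q)_n β_n`. -/
theorem sum_qBinom_mul_baileySum {q : ℂ} (hq : ‖q‖ < 1) (α : ℕ → ℂ) (L : ℕ) :
    ∑ n ∈ range (L + 1), q ^ (n + 1).choose 2 * qBinom q L n *
      (qPoch q q n * qPoch (-q) q n * baileySum q α n) =
    qPoch q q L * qPoch (-q) q L * baileySum q (fun r => α r * q ^ (r + 1).choose 2) L := by
  rw [mul_assoc (qPoch q q L), ← sum_baileySum_mul_qInv hq, mul_sum]
  refine sum_congr rfl fun n _ => ?_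
  rw [qBinom_eq, qInv_natCast]
  field_simp [qPoch_self_ne_zero hq n]

/-! ### Bailey sums of theta sequences. -/

/-- The terms of the theta series of `(z, w, zw; zw)_∞`. For `z = q` and `w = 1` they form the
`α`-sequence of the unit Bailey pair relative to `q`. -/
noncomputable def thetaTerm (z w : ℂ) (r : ℕ) : ℂ :=
  (-1) ^ r * z ^ r.choose 2 * w ^ (r + 1).choose 2 * (1 - z ^ (2 * r + 1))

theorem thetaTerm_mul_pow (z w q : ℂ) :
    (fun r => thetaTerm z w r * q ^ (r + 1).choose 2) = thetaTerm z (w * q) := by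
  funext r
  unfold thetaTerm
  ring

/-- The factor 1 - q^L makes the partial sums telescope. At R = L the closed form cancels the last
term of the Bailey sum. -/
theorem sum_thetaTerm_mul_baileyKernel {q : ℂ} (hq : ‖q‖ < 1) (L R : ℕ) (hR : R ≤ L) :
    (1 - q ^ L) * ∑ r ∈ range R, thetaTerm q 1 r * baileyKernel q L r =
      -((1 - q ^ R) * (-1) ^ R * q ^ R.choose 2 *
        (qInv q ((L : ℤ) - R) * qInv q ((L : ℤ) + R))) := by
  induction R with
  | zero => simp
  | succ R ih =>
    obtain ⟨k, rfl⟩ := Nat.exists_eq_add_of_le hR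
    have h1 : qInv q (((R + 1 + k : ℕ) : ℤ) - R) = qInv q ((k + 1 : ℕ) : ℤ) := by
      congr 1; push_cast; ring
    have h2 : qInv q (((R + 1 + k : ℕ) : ℤ) + R) =
        (1 - q ^ (2 * R + k + 2)) * qInv q ((2 * R + k + 2 : ℕ) : ℤ) := by
      rw [← qInv_natCast_eq hq]; congr 1; push_cast; ring
    have h3 : qInv q (((R + 1 + k : ℕ) : ℤ) + R + 1) = qInv q ((2 * R + k + 2 : ℕ) : ℤ) := by
      congr 1; push_cast; ring
    have h4 : qInv q (((R + 1 + k : ℕ) : ℤ) - (R + 1 : ℕ)) =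
        (1 - q ^ (k + 1)) * qInv q ((k + 1 : ℕ) : ℤ) := by
      rw [← qInv_natCast_eq hq]; congr 1; push_cast; ring
    have h5 : qInv q (((R + 1 + k : ℕ) : ℤ) + (R + 1 : ℕ)) = qInv q ((2 * R + k + 2 : ℕ) : ℤ) := by
      congr 1; push_cast; ring
    rw [sum_range_succ, mul_add, ih (by omega), baileyKernel, h1, h2, h3, h4, h5, thetaTerm,
      Nat.choose_succ_succ' R 1, Nat.choose_one_right]
    ring

theorem baileySum_thetaTerm_unit {q : ℂ} (hq : ‖q‖ < 1) (L : ℕ) :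
    baileySum q (thetaTerm q 1) L = if L = 0 then 1 else 0 := by
  split_ifs with h
  · subst h
    have : 1 - q ≠ 0 := by simpa using one_sub_pow_ne_zero hq 0
    simp [baileySum, thetaTerm, baileyKernel, qInv, qPoch, this]
  · obtain ⟨k, rfl⟩ := Nat.exists_eq_succ_of_ne_zero h
    apply mul_left_cancel₀ (one_sub_pow_ne_zero hq k)
    rw [baileySum, sum_range_succ, mul_add, sum_thetaTerm_mul_baileyKernel hq _ _ le_rfl, baileyKernel,
      mul_zero]
    have h2 : qInv q (((k + 1 : ℕ) : ℤ) + (k + 1 : ℕ)) =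
        (1 - q ^ (2 * (k + 1) + 1)) * qInv q (((k + 1 : ℕ) : ℤ) + (k + 1 : ℕ) + 1) := by
      have := qInv_natCast_eq hq (2 * (k + 1))
      rw [show ((2 * (k + 1) : ℕ) : ℤ) = ((k + 1 : ℕ) : ℤ) + (k + 1 : ℕ) by push_cast; ring,
        show ((2 * (k + 1) + 1 : ℕ) : ℤ) = ((k + 1 : ℕ) : ℤ) + (k + 1 : ℕ) + 1 by
          push_cast; ring] at this
      exact this
    rw [h2, thetaTerm]
    ring

theorem baileySum_thetaTerm_self {q : ℂ} (hq : ‖q‖ < 1) (L : ℕ) :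
    qPoch q q L * qPoch (-q) q L * baileySum q (thetaTerm q q) L = 1 := by
  -- Writing w = 1 * q exhibits one step from the unit pair, so only n = 0 contributes.
  rw [← one_mul q, ← thetaTerm_mul_pow, one_mul, ← sum_qBinom_mul_baileySum hq, sum_range_succ', sum_eq_zero]
  · simp [baileySum_thetaTerm_unit hq, qPoch_zero, qBinom_zero_right hq]
  · intro n _
    simp [baileySum_thetaTerm_unit hq]

/-- The difference of the two sums telescopes, and both boundary terms vanish at R = L + 2. -/
theorem sum_thetaTerm_shift {q : ℂ} (hq : ‖q‖ < 1) (a L R : ℕ) (hR : R ≤ L + 2) :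
    (1 - q ^ (2 * L + 2)) * ∑ r ∈ range R, thetaTerm q (q ^ (a + 1)) r * baileyKernel q (L + 1) r -
        ∑ r ∈ range R, thetaTerm (q ^ (a + 1)) q r * baileyKernel q L r =
      (-1) ^ R * q ^ ((a + 2) * R.choose 2 + R) * baileyKernel q L R -
        (-1) ^ R * q ^ (R.choose 2 + (a + 1) * (R + 1).choose 2) *
          (qInv q ((L : ℤ) + 1 - R) * qInv q ((L : ℤ) + R)) := by
  induction R with
  | zero =>
    simp only [baileyKernel, range_zero, sum_empty, Nat.choose_zero_succ, Nat.cast_zero, pow_zero,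
      mul_zero, sub_zero, add_zero, zero_add, Nat.choose_succ_self]
    ring
  | succ R ih =>
    obtain ⟨k, hk⟩ := Nat.exists_eq_add_of_le (show R ≤ L + 1 by omega)
    have hL : (L : ℤ) = R + k - 1 := by omega
    have h1 : qInv q ((L : ℤ) - R) = (1 - q ^ k) * qInv q k := by
      rw [← qInv_sub_one hq]; congr 1; omega
    have h2 : qInv q ((L : ℤ) + R) = (1 - q ^ (2 * R + k)) * ((1 - q ^ (2 * R + k + 1)) *
        qInv q ((2 * R + k + 1 : ℕ) : ℤ)) := by
      rw [← qInv_natCast_eq hq, ← qInv_sub_one hq]; congr 1; push_cast; omega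
    have h3 : qInv q ((L : ℤ) + R + 1) =
        (1 - q ^ (2 * R + k + 1)) * qInv q ((2 * R + k + 1 : ℕ) : ℤ) := by
      rw [← qInv_natCast_eq hq]; congr 1; push_cast; omega
    -- Truncation of k - 1 at k = 0 is harmless: 1 - q^k vanishes there.
    have h4 : qInv q ((L : ℤ) - (R + 1 : ℕ)) = (1 - q ^ k) * (1 - q ^ (k - 1)) * qInv q k := by
      cases k with
      | zero => rw [qInv_of_neg q (by push_cast; omega)]; simp
      | succ k =>
        rw [Nat.add_sub_cancel, mul_right_comm, ← qInv_natCast_eq hq, mul_comm, ← qInv_sub_one hq]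
        congr 1; push_cast; omega
    have h5 : qInv q ((L : ℤ) + (R + 1 : ℕ) + 1) = qInv q ((2 * R + k + 1 : ℕ) : ℤ) := by
      congr 1; push_cast; omega
    have h6 : qInv q ((L : ℤ) + 1 - (R + 1 : ℕ)) = (1 - q ^ k) * qInv q k := by
      rw [← h1]; congr 1; push_cast; ring
    have h7 : qInv q ((L : ℤ) + (R + 1 : ℕ)) =
        (1 - q ^ (2 * R + k + 1)) * qInv q ((2 * R + k + 1 : ℕ) : ℤ) := by
      rw [← h3]; congr 1
    have h8 : qInv q ((L : ℤ) + 1 - R) = qInv q k := by congr 1; omega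
    have h9 : qInv q (((L + 1 : ℕ) : ℤ) - R) = qInv q k := by congr 1; push_cast; omega
    have h10 : qInv q (((L + 1 : ℕ) : ℤ) + R + 1) = qInv q ((2 * R + k + 1 : ℕ) : ℤ) := by
      congr 1; push_cast; omega
    rw [sum_range_succ, sum_range_succ, mul_add, add_sub_add_comm, ih (by omega), baileyKernel,
      baileyKernel, baileyKernel, h1, h2, h3, h4, h5, h6, h7, h8, h9, h10, thetaTerm, thetaTerm,
      show 2 * L + 2 = 2 * R + 2 * k by omega,
      Nat.choose_succ_succ' (R + 1) 1, Nat.choose_succ_succ' R 1, Nat.choose_one_right,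
      Nat.choose_one_right]
    cases k with
    | zero => ring
    | succ k => rw [Nat.add_sub_cancel]; ring

theorem baileySum_thetaTerm_shift {q : ℂ} (hq : ‖q‖ < 1) (a L : ℕ) :
    (1 - q ^ (2 * L + 2)) * baileySum q (thetaTerm q (q ^ (a + 1))) (L + 1) =
      baileySum q (thetaTerm (q ^ (a + 1)) q) L := by
  have h := sum_thetaTerm_shift hq a L (L + 2) le_rfl
  rw [baileyKernel_of_lt q (by omega), qInv_of_neg q (n := (L : ℤ) + 1 - (L + 2 : ℕ)) (by omega),
    zero_mul, mul_zero, mul_zero, sub_zero, sub_eq_zero] at h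
  rw [baileySum, h, baileySum_eq_sum_range q _ (Nat.le_succ (L + 1))]

/-! ### Limits L → ∞ by dominated convergence. -/

theorem tendsto_sum_mul_qInv {q : ℂ} (hq : ‖q‖ < 1) {s : ℕ → ℂ} (hs : Summable fun n => ‖s n‖) :
    Tendsto (fun L : ℕ => ∑ n ∈ range (L + 1), s n * qInv q ((L : ℤ) - n)) atTop
      (𝓝 ((∑' n, s n) * (qPochInf q q)⁻¹)) := by
  obtain ⟨K, hK0, hK⟩ := exists_norm_qInv_le hq
  have h : Tendsto (fun L : ℕ => ∑' n, s n * qInv q ((L : ℤ) - n)) atTop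
      (𝓝 (∑' n, s n * (qPochInf q q)⁻¹)) := by
    refine tendsto_tsum_of_dominated_convergence (hs.mul_right K) (fun n => ?_)
      (Eventually.of_forall fun L n => ?_)
    · refine ((tendsto_qInv hq).comp ?_).const_mul _
      exact tendsto_atTop_add_const_right _ _ tendsto_natCast_atTop_atTop
    · rw [norm_mul]
      exact mul_le_mul_of_nonneg_left (hK _) (norm_nonneg _)
  rw [tsum_mul_right] at h
  refine h.congr fun L => tsum_eq_sum fun n hn => ?_
  rw [qInv_of_neg q (by have := mt mem_range.2 hn; omega), mul_zero]

theorem tendsto_baileySum {q : ℂ} (hq : ‖q‖ < 1) {α : ℕ → ℂ} (hα : Summable fun r => ‖α r‖) :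
    Tendsto (baileySum q α) atTop
      (𝓝 ((∑' r, α r) * ((qPochInf q q)⁻¹ * (qPochInf q q)⁻¹))) := by
  obtain ⟨K, hK0, hK⟩ := exists_norm_qInv_le hq
  have h : Tendsto (fun L : ℕ => ∑' r, α r * baileyKernel q L r) atTop
      (𝓝 (∑' r, α r * ((qPochInf q q)⁻¹ * (qPochInf q q)⁻¹))) := by
    refine tendsto_tsum_of_dominated_convergence (hα.mul_right (K * K)) (fun n => ?_)
      (Eventually.of_forall fun L n => ?_)
    · refine (((tendsto_qInv hq).comp ?_).mul ((tendsto_qInv hq).comp ?_)).const_mul _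
      · exact tendsto_atTop_add_const_right _ _ tendsto_natCast_atTop_atTop
      · exact tendsto_atTop_add_const_right _ _
          (tendsto_atTop_add_const_right _ _ tendsto_natCast_atTop_atTop)
    · rw [norm_mul, baileyKernel, norm_mul]
      exact mul_le_mul_of_nonneg_left (mul_le_mul (hK _) (hK _) (norm_nonneg _) hK0)
        (norm_nonneg _)
  rw [tsum_mul_right] at h
  refine h.congr fun L => tsum_eq_sum fun n hn => ?_
  rw [baileyKernel_of_lt q (by have := mt mem_range.2 hn; omega), mul_zero]

/-! ### The Jacobi triple product. -/

/-- A telescoping certificate for the recurrence in n: the weights are the growth factors of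
(z)_{n+1}(w)_n and (zw)_{2n+1} to base zw. The variable s stands for n + 1 - R without truncation.
-/
theorem sum_thetaTerm_step {z w : ℂ} (hp : ‖z * w‖ < 1) (n R s : ℕ) (hR : R + s = n + 1) :
    ∑ r ∈ range R, ((1 - z * (z * w) ^ (n + 1)) * (1 - w * (z * w) ^ n) *
        (thetaTerm z w r * baileyKernel (z * w) n r) -
        (1 - (z * w) ^ (2 * n + 2)) * (1 - (z * w) ^ (2 * n + 3)) *
        (thetaTerm z w r * baileyKernel (z * w) (n + 1) r)) =
      (z * w) ^ s * thetaTerm z w R *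
        (qInv (z * w) ((n : ℤ) + 1 - R) * qInv (z * w) ((n : ℤ) + R)) +
      (-1) ^ R * z ^ R.choose 2 * w ^ (R + 1).choose 2 *
        (z * (z * w) ^ (n + 1) - w * z ^ (2 * R + 1) * (z * w) ^ n) *
          baileyKernel (z * w) n R := by
  induction R generalizing s with
  | zero =>
    obtain rfl : s = n + 1 := by omega
    simp only [range_zero, sum_empty, baileyKernel, thetaTerm, Nat.choose_zero_succ, Nat.cast_zero,
      pow_zero, mul_zero, sub_zero, add_zero, zero_add, Nat.choose_succ_self]
    ring
  | succ R ih =>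
    have hn : (n : ℤ) = R + s := by omega
    have h1 : qInv (z * w) ((n : ℤ) + 1 - R) = qInv (z * w) ((s + 1 : ℕ) : ℤ) := by
      congr 1; push_cast; omega
    have h2 : qInv (z * w) ((n : ℤ) + R) = (1 - (z * w) ^ (2 * R + s + 1)) *
        ((1 - (z * w) ^ (2 * R + s + 2)) * qInv (z * w) ((2 * R + s + 2 : ℕ) : ℤ)) := by
      rw [← qInv_natCast_eq hp, ← qInv_natCast_eq hp]; congr 1; push_cast; omega
    have h3 : qInv (z * w) ((n : ℤ) - R) =
        (1 - (z * w) ^ (s + 1)) * qInv (z * w) ((s + 1 : ℕ) : ℤ) := by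
      rw [← qInv_natCast_eq hp]; congr 1; omega
    have h4 : qInv (z * w) ((n : ℤ) + R + 1) =
        (1 - (z * w) ^ (2 * R + s + 2)) * qInv (z * w) ((2 * R + s + 2 : ℕ) : ℤ) := by
      rw [← qInv_natCast_eq hp]; congr 1; push_cast; omega
    have h5 : qInv (z * w) (((n + 1 : ℕ) : ℤ) - R) = qInv (z * w) ((s + 1 : ℕ) : ℤ) := by
      congr 1; push_cast; omega
    have h6 : qInv (z * w) (((n + 1 : ℕ) : ℤ) + R + 1) =
        qInv (z * w) ((2 * R + s + 2 : ℕ) : ℤ) := by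
      congr 1; push_cast; omega
    have h7 : qInv (z * w) ((n : ℤ) + 1 - (R + 1 : ℕ)) =
        (1 - (z * w) ^ (s + 1)) * qInv (z * w) ((s + 1 : ℕ) : ℤ) := by
      rw [← h3]; congr 1; push_cast; ring
    have h8 : qInv (z * w) ((n : ℤ) + (R + 1 : ℕ)) =
        (1 - (z * w) ^ (2 * R + s + 2)) * qInv (z * w) ((2 * R + s + 2 : ℕ) : ℤ) := by
      rw [← h4]; congr 1
    have h9 : qInv (z * w) ((n : ℤ) - (R + 1 : ℕ)) =
        (1 - (z * w) ^ s) * ((1 - (z * w) ^ (s + 1)) * qInv (z * w) ((s + 1 : ℕ) : ℤ)) := by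
      rw [← qInv_natCast_eq hp, ← qInv_sub_one hp]; congr 1; push_cast; omega
    have h10 : qInv (z * w) ((n : ℤ) + (R + 1 : ℕ) + 1) =
        qInv (z * w) ((2 * R + s + 2 : ℕ) : ℤ) := by
      congr 1; push_cast; omega
    obtain rfl : n = R + s := by omega
    rw [sum_range_succ, ih (s + 1) (by omega), baileyKernel, baileyKernel, baileyKernel, h1, h2, h3,
      h4, h5, h6, h7, h8, h9, h10, thetaTerm, thetaTerm,
      Nat.choose_succ_succ' (R + 1) 1, Nat.choose_succ_succ' R 1, Nat.choose_one_right,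
      Nat.choose_one_right]
    generalize qInv (z * w) ((2 * R + s + 2 : ℕ) : ℤ) = U
    generalize qInv (z * w) ((s + 1 : ℕ) : ℤ) = V
    ring

/-- At R = n + 1 the surviving boundary term is the extra summand r = n + 1 of the longer sum. -/
theorem baileySum_thetaTerm_succ {z w : ℂ} (hp : ‖z * w‖ < 1) (n : ℕ) :
    (1 - z * (z * w) ^ (n + 1)) * (1 - w * (z * w) ^ n) *
        baileySum (z * w) (thetaTerm z w) n =
      (1 - (z * w) ^ (2 * n + 2)) * (1 - (z * w) ^ (2 * n + 3)) *
        baileySum (z * w) (thetaTerm z w) (n + 1) := by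
  have h := sum_thetaTerm_step hp n (n + 1) 0 rfl
  rw [sum_sub_distrib, ← mul_sum, ← mul_sum, baileyKernel_of_lt _ (Nat.lt_succ_self n), mul_zero,
    add_zero, pow_zero, one_mul] at h
  have h1 : qInv (z * w) ((n : ℤ) + 1 - (n + 1 : ℕ)) =
      qInv (z * w) (((n + 1 : ℕ) : ℤ) - (n + 1 : ℕ)) := by
    push_cast; rfl
  have h2 : qInv (z * w) ((n : ℤ) + (n + 1 : ℕ)) =
      (1 - (z * w) ^ (2 * n + 2)) * ((1 - (z * w) ^ (2 * n + 3)) *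
        qInv (z * w) (((n + 1 : ℕ) : ℤ) + (n + 1 : ℕ) + 1)) := by
    have e : ((n + 1 : ℕ) : ℤ) + (n + 1 : ℕ) + 1 = (2 * n + 3 : ℕ) := by push_cast; ring
    rw [e, ← qInv_natCast_eq hp, ← qInv_natCast_eq hp]; congr 1; push_cast; ring
  rw [h1, h2] at h
  rw [baileySum, baileySum, sum_range_succ _ (n + 1), baileyKernel.eq_1 _ (n + 1) (n + 1)]
  linear_combination h

/-- A finite form of the Jacobi triple product identity. -/
theorem qPoch_mul_qPoch_eq_baileySum {z w : ℂ} (hp : ‖z * w‖ < 1) (n : ℕ) :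
    qPoch z (z * w) (n + 1) * qPoch w (z * w) n =
      qPoch (z * w) (z * w) (2 * n + 1) * baileySum (z * w) (thetaTerm z w) n := by
  induction n with
  | zero =>
    have : 1 - z * w ≠ 0 := by simpa using one_sub_pow_ne_zero hp 0
    simp [baileySum, thetaTerm, baileyKernel, qInv, qPoch]
    field_simp
  | succ n ih =>
    rw [qPoch_succ, qPoch_succ w, show 2 * (n + 1) + 1 = 2 * n + 1 + 1 + 1 by ring,
      qPoch_self_succ, qPoch_self_succ]
    linear_combination (1 - z * (z * w) ^ (n + 1)) * (1 - w * (z * w) ^ n) * ih +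
      qPoch (z * w) (z * w) (2 * n + 1) * baileySum_thetaTerm_succ hp n

theorem le_choose_two_add (r : ℕ) : r ≤ (r + 1).choose 2 := by
  rw [Nat.choose_succ_succ' r 1, Nat.choose_one_right]
  exact Nat.le_add_right _ _

theorem summable_norm_thetaTerm {z w : ℂ} (hz : ‖z‖ < 1) (hw : ‖w‖ < 1) :
    Summable fun r => ‖thetaTerm z w r‖ := by
  refine Summable.of_nonneg_of_le (fun _ => norm_nonneg _) (fun r => ?_)
    ((summable_geometric_of_lt_one (norm_nonneg w) hw).mul_right 2)
  rw [thetaTerm, norm_mul, norm_mul, norm_mul, norm_pow, norm_pow, norm_pow, norm_neg, norm_one,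
    one_pow, one_mul]
  refine mul_le_mul ?_ ?_ (norm_nonneg _) (by positivity)
  · refine (mul_le_of_le_one_left (by positivity) (pow_le_one₀ (norm_nonneg z) hz.le)).trans ?_
    exact pow_le_pow_of_le_one (norm_nonneg w) hw.le (le_choose_two_add r)
  · refine (norm_sub_le _ _).trans ?_
    rw [norm_one, norm_pow]
    have := pow_le_one₀ (n := 2 * r + 1) (norm_nonneg z) hz.le
    linarith

/-- The Jacobi triple product identity. -/
theorem tsum_thetaTerm {z w : ℂ} (hz : ‖z‖ < 1) (hw : ‖w‖ < 1) :
    ∑' r, thetaTerm z w r =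
      qPochInf z (z * w) * qPochInf w (z * w) * qPochInf (z * w) (z * w) := by
  have hp : ‖z * w‖ < 1 := by
    rw [norm_mul]; exact mul_lt_one_of_nonneg_of_lt_one_left (norm_nonneg z) hz hw.le
  have h1 := ((tendsto_add_atTop_iff_nat 1).2 (tendsto_qPoch z hp)).mul (tendsto_qPoch w hp)
  have h2 : Tendsto (fun n => qPoch (z * w) (z * w) (2 * n + 1)) atTop
      (𝓝 (qPochInf (z * w) (z * w))) :=
    (tendsto_qPoch _ hp).comp (tendsto_atTop_mono (fun n => show n ≤ 2 * n + 1 by omega) tendsto_id)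
  have h3 := h2.mul (tendsto_baileySum hp (summable_norm_thetaTerm hz hw))
  simp only [← qPoch_mul_qPoch_eq_baileySum hp] at h3
  have h4 := tendsto_nhds_unique h1 h3
  have := qPochInf_self_ne_zero hp
  rw [h4]
  field_simp

/-! ### The inner sums along the Bailey chain. -/

theorem exists_norm_qBinom_le {q : ℂ} (hq : ‖q‖ < 1) : ∃ K, 0 ≤ K ∧ ∀ n k, ‖qBinom q n k‖ ≤ K := by
  obtain ⟨A, hA0, hA⟩ := exists_norm_qPoch_le q hq
  obtain ⟨B, hB0, hB⟩ := exists_norm_qInv_le hq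
  refine ⟨A * (B * B), by positivity, fun n k => ?_⟩
  rw [qBinom_eq, norm_mul, norm_mul]
  exact mul_le_mul (hA _) (mul_le_mul (hB _) (hB _) (norm_nonneg _) hB0) (by positivity) hA0

/-- The sum over `n_1, …, n_k` for fixed `n_{k+1} = N`, defined recursively. -/
noncomputable def multiSum (q : ℂ) (a : ℕ) : ℕ → ℕ → ℂ
  | 0, _ => 1
  | k + 1, N => ∑ n ∈ range (N + 2), q ^ (n + 1).choose 2 *
      qBinom q (N + if a = k + 1 then 1 else 0) n * multiSum q a k n

/-- The range `N + 2` makes room for δ; without δ its top term vanishes. -/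
theorem multiSum_succ_of_ne (q : ℂ) {a k : ℕ} (h : a ≠ k + 1) (N : ℕ) :
    multiSum q a (k + 1) N =
      ∑ n ∈ range (N + 1), q ^ (n + 1).choose 2 * qBinom q N n * multiSum q a k n := by
  rw [multiSum, sum_range_succ, if_neg h, add_zero, qBinom_of_lt q N.lt_succ_self, mul_zero,
    zero_mul, add_zero]

theorem multiSum_succ_self (q : ℂ) (k N : ℕ) :
    multiSum q (k + 1) (k + 1) N =
      ∑ n ∈ range (N + 1 + 1), q ^ (n + 1).choose 2 * qBinom q (N + 1) n *
        multiSum q (k + 1) k n := by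
  rw [multiSum, if_pos rfl]

theorem multiSum_of_lt {q : ℂ} (hq : ‖q‖ < 1) {a k : ℕ} (h : k < a) (N : ℕ) :
    multiSum q a k N =
      qPoch q q N * qPoch (-q) q N * baileySum q (thetaTerm q (q ^ (k + 1))) N := by
  induction k generalizing N with
  | zero => rw [zero_add, pow_one, baileySum_thetaTerm_self hq, multiSum]
  | succ k ih =>
    rw [multiSum_succ_of_ne q h.ne', sum_congr rfl fun n _ => by rw [ih (k.lt_succ_self.trans h)],
      sum_qBinom_mul_baileySum hq, thetaTerm_mul_pow, ← pow_succ]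

theorem multiSum_self {q : ℂ} (hq : ‖q‖ < 1) (a N : ℕ) :
    multiSum q a a N =
      qPoch q q N * qPoch (-q) q N * baileySum q (thetaTerm (q ^ (a + 1)) q) N := by
  -- For a = 0 there is no δ, but the sum is constantly 1, so N + 1 may replace N. The shift then
  -- absorbs (1 - q^{N+1})(1 + q^{N+1}) = 1 - q^{2N+2}.
  have h : multiSum q a a N = qPoch q q (N + 1) * qPoch (-q) q (N + 1) *
      baileySum q (thetaTerm q (q ^ (a + 1))) (N + 1) := by
    cases a with
    | zero => rw [zero_add, pow_one, baileySum_thetaTerm_self hq, multiSum]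
    | succ k =>
      rw [multiSum_succ_self, sum_congr rfl fun n _ => by rw [multiSum_of_lt hq k.lt_succ_self],
        sum_qBinom_mul_baileySum hq, thetaTerm_mul_pow, ← pow_succ]
  rw [h, ← baileySum_thetaTerm_shift hq, qPoch_succ, qPoch_succ]
  ring

theorem multiSum_add {q : ℂ} (hq : ‖q‖ < 1) (a j N : ℕ) :
    multiSum q a (a + j) N =
      qPoch q q N * qPoch (-q) q N *
        baileySum q (thetaTerm (q ^ (a + 1)) (q ^ (j + 1))) N := by
  induction j generalizing N with
  | zero => rw [add_zero, zero_add, pow_one, multiSum_self hq]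
  | succ j ih =>
    rw [← add_assoc, multiSum_succ_of_ne q (by omega), sum_congr rfl fun n _ => by rw [ih],
      sum_qBinom_mul_baileySum hq, thetaTerm_mul_pow, ← pow_succ]

/-! ### Absolute convergence and iterated summation. -/

/-- The summand of `multiSum q a k (n (Fin.last k))`. -/
noncomputable def chainTerm (q : ℂ) (a k : ℕ) (n : Fin (k + 1) → ℕ) : ℂ :=
  q ^ (∑ i : Fin k, (n i.castSucc + 1).choose 2) *
    ∏ i : Fin k, qBinom q (n i.succ + if a = (i : ℕ) + 1 then 1 else 0) (n i.castSucc)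

theorem chainTerm_snoc (q : ℂ) (a k : ℕ) (n : Fin (k + 1) → ℕ) (N : ℕ) :
    chainTerm q a (k + 1) (Fin.snoc n N) = q ^ (n (Fin.last k) + 1).choose 2 *
      qBinom q (N + if a = k + 1 then 1 else 0) (n (Fin.last k)) * chainTerm q a k n := by
  unfold chainTerm
  rw [Fin.sum_univ_castSucc, Fin.prod_univ_castSucc]
  simp only [Fin.snoc_castSucc, Fin.succ_castSucc, Fin.succ_last, Fin.snoc_last, Fin.val_castSucc,
    Fin.val_last, pow_add]
  ring

theorem summable_prod_pow {x : ℝ} (h0 : 0 ≤ x) (h1 : x < 1) (k : ℕ) :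
    Summable fun n : Fin k → ℕ => ∏ i, x ^ n i := by
  induction k with
  | zero => exact (hasSum_fintype _).summable
  | succ k ih =>
    rw [← (Fin.snocEquiv fun _ => ℕ).summable_iff]
    refine ((summable_geometric_of_lt_one h0 h1).mul_of_nonneg ih (fun _ => by positivity)
      (fun _ => by positivity)).congr fun p => ?_
    simp [Fin.prod_univ_castSucc, mul_comm]

theorem norm_pow_sum_choose_le {q : ℂ} (hq : ‖q‖ < 1) {k : ℕ} (n : Fin k → ℕ) :
    ‖q ^ (∑ i, (n i + 1).choose 2)‖ ≤ ∏ i, ‖q‖ ^ n i := by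
  rw [norm_pow, prod_pow_eq_pow_sum]
  exact pow_le_pow_of_le_one (norm_nonneg q) hq.le (sum_le_sum fun i _ => le_choose_two_add (n i))

/-- Bounded binomials and C(n+1, 2) ≥ n give a geometric majorant in all variables but the last,
which is fixed or weighted separately. -/
theorem exists_norm_chainTerm_le {q : ℂ} (hq : ‖q‖ < 1) (a k : ℕ) : ∃ K, 0 ≤ K ∧
    ∀ n, ‖chainTerm q a k n‖ ≤ (∏ i : Fin k, ‖q‖ ^ n i.castSucc) * K := by
  obtain ⟨K, hK0, hK⟩ := exists_norm_qBinom_le hq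
  refine ⟨K ^ k, by positivity, fun n => ?_⟩
  rw [chainTerm, norm_mul]
  refine mul_le_mul (norm_pow_sum_choose_le hq fun i => n i.castSucc) ?_ (norm_nonneg _)
    (by positivity)
  rw [norm_prod]
  exact (prod_le_prod (fun _ _ => norm_nonneg _) fun i _ => hK _ _).trans_eq (by simp)

theorem hasSum_fin_succ {k : ℕ} {f : (Fin (k + 1) → ℕ) → ℂ} (hf : Summable f) {g : ℕ → ℂ}
    (h : ∀ N, HasSum (fun n : Fin k → ℕ => f (Fin.snoc n N)) (g N)) : HasSum f (∑' N, g N) := by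
  have hf' := (Fin.snocEquiv fun _ => ℕ).summable_iff.2 hf
  rw [← (Fin.snocEquiv fun _ => ℕ).hasSum_iff, (hf'.hasSum.prod_fiberwise h).tsum_eq]
  exact hf'.hasSum

theorem hasSum_chainTerm {q : ℂ} (hq : ‖q‖ < 1) (a k N : ℕ) :
    HasSum (fun n : Fin k → ℕ => chainTerm q a k (Fin.snoc n N)) (multiSum q a k N) := by
  induction k generalizing N with
  | zero =>
    convert hasSum_unique (fun n : Fin 0 → ℕ => chainTerm q a 0 (Fin.snoc n N)) using 1
    simp [multiSum, chainTerm]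
  | succ k ih =>
    obtain ⟨K, hK0, hK⟩ := exists_norm_chainTerm_le hq a (k + 1)
    have hs : Summable fun n : Fin (k + 1) → ℕ => chainTerm q a (k + 1) (Fin.snoc n N) := by
      refine Summable.of_norm_bounded ((summable_prod_pow (norm_nonneg q) hq (k + 1)).mul_right K)
        fun n => (hK _).trans_eq ?_
      simp only [Fin.snoc_castSucc]
    convert hasSum_fin_succ hs (g := fun M => q ^ (M + 1).choose 2 *
      qBinom q (N + if a = k + 1 then 1 else 0) M * multiSum q a k M) fun M => ?_ using 1
    · rw [multiSum, tsum_eq_sum]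
      intro n hn
      rw [qBinom_of_lt, mul_zero, zero_mul]
      have := mt mem_range.2 hn
      split_ifs <;> omega
    · simp only [chainTerm_snoc, Fin.snoc_last]
      exact (ih M).mul_left _

theorem norm_pow_choose_le {q : ℂ} (hq : ‖q‖ < 1) (n : ℕ) :
    ‖q ^ (n + 1).choose 2‖ ≤ ‖q‖ ^ n := by
  rw [norm_pow]
  exact pow_le_pow_of_le_one (norm_nonneg q) hq.le (le_choose_two_add n)

/-! ### The outermost sum and the theorem. -/

/-- This is `sum_baileySum_mul_qInv` as L → ∞, with one factor 1/(q)_∞ cancelled. -/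
theorem tsum_mul_baileySum {q z w : ℂ} (hq : ‖q‖ < 1) (hz : ‖z‖ < 1) (hw : ‖w‖ < 1) :
    ∑' n, q ^ (n + 1).choose 2 * (qPoch (-q) q n * baileySum q (thetaTerm z w) n) =
      qPochInf (-q) q * (∑' r, thetaTerm z (w * q) r) * (qPochInf q q)⁻¹ := by
  have hwq : ‖w * q‖ < 1 := by
    rw [norm_mul]; exact mul_lt_one_of_nonneg_of_lt_one_left (norm_nonneg w) hw hq.le
  have hs : Summable fun n =>
      ‖q ^ (n + 1).choose 2 * (qPoch (-q) q n * baileySum q (thetaTerm z w) n)‖ := by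
    obtain ⟨K, hK⟩ := ((tendsto_qPoch (-q) hq).mul
      (tendsto_baileySum hq (summable_norm_thetaTerm hz hw))).norm.bddAbove_range
    refine Summable.of_nonneg_of_le (fun _ => norm_nonneg _) (fun n => ?_)
      ((summable_geometric_of_lt_one (norm_nonneg q) hq).mul_right K)
    rw [norm_mul]
    exact mul_le_mul (norm_pow_choose_le hq n) (hK ⟨n, rfl⟩) (norm_nonneg _) (by positivity)
  have h1 := tendsto_sum_mul_qInv hq hs
  simp only [sum_baileySum_mul_qInv hq, thetaTerm_mul_pow] at h1
  have h2 := tendsto_nhds_unique h1 ((tendsto_qPoch (-q) hq).mul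
    (tendsto_baileySum hq (summable_norm_thetaTerm hz hwq)))
  have := qPochInf_self_ne_zero hq
  field_simp at h2 ⊢
  exact h2

theorem tsum_mul_multiSum {q : ℂ} (hq : ‖q‖ < 1) (a j : ℕ) :
    ∑' N, q ^ (N + 1).choose 2 / qPoch q q N * multiSum q a (a + j) N =
      qPochInf (q ^ (a + 1)) (q ^ (a + j + 3)) * qPochInf (q ^ (j + 2)) (q ^ (a + j + 3)) *
          qPochInf (q ^ (a + j + 3)) (q ^ (a + j + 3)) /
        (qPochInf q q * qPochInf q (q ^ 2)) := by
  have hpow : ∀ n, ‖q ^ (n + 1)‖ < 1 := fun n => by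
    rw [norm_pow]; exact pow_lt_one₀ (norm_nonneg q) hq n.succ_ne_zero
  have h : ∀ N, q ^ (N + 1).choose 2 / qPoch q q N * multiSum q a (a + j) N =
      q ^ (N + 1).choose 2 *
        (qPoch (-q) q N * baileySum q (thetaTerm (q ^ (a + 1)) (q ^ (j + 1))) N) := fun N => by
    rw [multiSum_add hq]
    field_simp [qPoch_self_ne_zero hq N]
  rw [tsum_congr h, tsum_mul_baileySum hq (hpow a) (hpow j), ← pow_succ,
    tsum_thetaTerm (hpow a) (hpow (j + 1)), ← pow_add,
    show a + 1 + (j + 1 + 1) = a + j + 3 by ring]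
  have h1 := qPochInf_sq_mul_qPochInf_neg hq
  have h2 := qPochInf_self_ne_zero hq
  have h3 : qPochInf q (q ^ 2) ≠ 0 := left_ne_zero_of_mul_eq_one h1
  rw [eq_div_iff (mul_ne_zero h2 h3)]
  generalize qPochInf (q ^ (a + 1)) (q ^ (a + j + 3)) * qPochInf (q ^ (j + 1 + 1)) (q ^ (a + j + 3)) *
    qPochInf (q ^ (a + j + 3)) (q ^ (a + j + 3)) = P
  field_simp
  linear_combination P * h1

/-- The summation variables `n_1, …, n_m` are `n 0, …, n (m - 1)`, so that the factor with index
`i : Fin (m - 1)` is the `q`-binomial coefficient `[n_{i+2} + δ_{a,i+1}; n_{i+1}]`. -/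
theorem theorem1p1 (m a : ℕ) (hm : 1 ≤ m) (ha : a ≤ m - 1) (q : ℂ) (hq : ‖q‖ < 1) :
    HasSum
      (fun n : Fin m → ℕ =>
        q ^ (∑ i : Fin m, (n i + 1).choose 2) / qPoch q q (n ⟨m - 1, by omega⟩) *
          ∏ i : Fin (m - 1),
            qBinom q (n ⟨(i : ℕ) + 1, by omega⟩ + if a = (i : ℕ) + 1 then 1 else 0)
              (n ⟨(i : ℕ), by omega⟩))
      (qPochInf (q ^ (a + 1)) (q ^ (m + 2)) * qPochInf (q ^ (m + 1 - a)) (q ^ (m + 2)) *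
          qPochInf (q ^ (m + 2)) (q ^ (m + 2)) /
        (qPochInf q q * qPochInf q (q ^ 2))) := by
  -- Here j counts the inner steps after the shift at level a.
  obtain ⟨j, rfl⟩ : ∃ j, m = a + j + 1 := ⟨m - 1 - a, by omega⟩
  rw [show a + j + 1 + 1 - a = j + 2 by omega, show a + j + 1 + 2 = a + j + 3 by ring,
    ← tsum_mul_multiSum hq]
  have hterm : ∀ n : Fin (a + j + 1) → ℕ,
      q ^ (∑ i, (n i + 1).choose 2) / qPoch q q (n (Fin.last (a + j))) *
        ∏ i : Fin (a + j), qBinom q (n i.succ + if a = (i : ℕ) + 1 then 1 else 0)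
          (n i.castSucc) =
      q ^ (n (Fin.last (a + j)) + 1).choose 2 / qPoch q q (n (Fin.last (a + j))) *
        chainTerm q a (a + j) n := fun n => by
    rw [Fin.sum_univ_castSucc, pow_add, chainTerm]
    ring
  refine HasSum.congr_fun (f := fun n : Fin (a + j + 1) → ℕ =>
    q ^ (n (Fin.last (a + j)) + 1).choose 2 / qPoch q q (n (Fin.last (a + j))) *
        chainTerm q a (a + j) n) ?_ hterm
  obtain ⟨A, hA0, hA⟩ := exists_norm_qInv_le hq
  obtain ⟨K, hK0, hK⟩ := exists_norm_chainTerm_le hq a (a + j)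
  -- The weight of n_m completes the geometric majorant, so the last variable can be summed
  -- outermost.
  refine hasSum_fin_succ (Summable.of_norm_bounded
    ((summable_prod_pow (norm_nonneg q) hq (a + j + 1)).mul_right (A * K)) fun n => ?_)
    fun N => ?_
  · rw [div_eq_mul_inv, ← qInv_natCast, norm_mul, norm_mul, Fin.prod_univ_castSucc]
    calc _ ≤ ‖q‖ ^ n (Fin.last (a + j)) * A *
          ((∏ i : Fin (a + j), ‖q‖ ^ n i.castSucc) * K) :=
          mul_le_mul (mul_le_mul (norm_pow_choose_le hq _) (hA _) (norm_nonneg _) (by positivity))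
            (hK n) (norm_nonneg _) (by positivity)
      _ = _ := by ring
  · simp only [Fin.snoc_last]
    exact (hasSum_chainTerm hq a (a + j) N).mul_left _
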